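/- **Setting.** Let $T=[\underline x,\bar x]\times[\underline y,\bar y]$ with $\underline x<\bar x$, $\underline y<\bar y$, and $L\in\mathbb R$. Let $\mathscr U$ be the set of continuous, componentwise non-decreasing $u:T\to[0,1]$ with $u(\underline x,\underline y)=0$, $u(\bar x,\bar y)=1$, with the conservative property $u(x,y)+u(x',y')\le u(x,y')+u(x',y)$ whenever $x<x'$, $y<y'$, and with $|u(x,y)-u(x',y')|\le L(|x-x'|+|y-y'|)$ on $T$. Let $\psi_1,\dots,\psi_M$ be real functions, each with a well-defined finite signed Lebesgue–Stieltjes measure $d\psi_l$ on $T$; that is, $d\psi_l([a,b]\times[c,d])$ is, for every rectangle $[a,b]\times[c,d]\subseteq T$, the limit as $\varepsilon\downarrow0$ of the mixed increment of $\psi_l$ over $[a-\varepsilon,b+\varepsilon]\times[c-\varepsilon,d+\varepsilon]$ (a function given only on $T$ is extended to $\mathbb R^2$ constantly in each variable, or by $0$ if it is the distribution function of a signed measure carried by $T$). Let $\int_T|d\psi_l|$ be the total variation of $d\psi_l$ on $T$. For $c\in\mathbb R^M$ put $\mathcal U=\{u\in\mathscr U:\int_T u\,d\psi_l\le c_l,\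 l=1,\dots,M\}$. For every $N\ge 2$ let $\underline x=x_1<\dots<x_N=\bar x$ and $\underline y=y_1<\dots<y_N=\bar y$ be grids of $N$ points (depending on $N$), with mesh sizes (maximal distance between consecutive points) $\beta_N^{x}\to0$ and $\beta_N^{y}\to0$ as $N\to\infty$. For $N_1,N_2\ge 2$ write $\beta_{N_1}=\beta^x_{N_1}$, $\beta_{N_2}=\beta^y_{N_2}$. Split every cell of the product of the $N_1$-point grid on $[\underline x,\bar x]$ and the $N_2$-point grid on $[\underline y,\bar y]$ into two triangles, by the main diagonal in every cell (Type 1), or by the counter diagonal in every cell (Type 2). Fix the type. Let $\mathcal U_N$ be the set of $u\in\mathcal U$ which are affine on each of these triangles. A *decision problem* consists of a nonempty compact convex set $Z\subset\mathbb R^n$, a probability measure $P$ on $\mathbb R^m$ carried by a compact set $\Xi$, and a continuous $\boldsymbol f:\mathbb R^n\times\mathbb R^m\to\mathbb R^2$ with $\boldsymbol f(Z\times\Xi)\subseteq T$. Put $v(z)=\inf_{u\in\mathcal U}\mathbb E_P[u(\boldsymbol f(z,\xi))]$ and $\vartheta=\sup_{z\in Z}v(z)$ (BUPRO), let $Z^*$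 be the set of maximizers of $v$ on $Z$, and let $v_N,\vartheta_N,Z_N^*$ be the same objects with $\mathcal U_N$ in place of $\mathcal U$ (BUPRO-N). Let $d(z,Z^*)=\inf_{z'\in Z^*}\|z-z'\|$, $\mathbb D(Z_N^*,Z^*)=\sup_{z\in Z_N^*}d(z,Z^*)$, $\Lambda(\tau)=\inf\{\vartheta-v(z):z\in Z,\ d(z,Z^*)\ge\tau\}$ (with $\inf\emptyset=+\infty$) and $\Lambda^{-1}(\eta)=\sup\{\tau:\Lambda(\tau)\le\eta\}$. **Theorem.** Suppose that Slater's condition holds: there are $\alpha>0$ and $u^0\in\mathcal U$ with $\bigl(\int_T u^0\,d\psi_l-c_l\bigr)_{l}+\alpha\,\mathbb B^M\subset\mathbb R^M_-$, where $\mathbb B^M$ is the Euclidean unit ball. Then for every $\hat\alpha\in(0,\alpha)$ there are $N_1^0,N_2^0$, not depending on the decision problem, such that for all $N_1\ge N_1^0$, $N_2\ge N_2^0$ the set $\mathcal U_N$ is nonempty, and for every decision problem $Z^*$ and $Z_N^*$ are nonempty and (i) $\displaystyle |\vartheta_N-\vartheta|\le B:=L(\beta_{N_1}+\beta_{N_2})\Bigl(3+\frac1{\hat\alpha}\Bigl(\sum_{l=1}^M\Bigl(\int_T|d\psi_l|\Bigr)^2\Bigr)^{1/2}\Bigr)$;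 (ii) $\displaystyle \mathbb D(Z_N^*,Z^*)\le\Lambda^{-1}(2B)$. If moreover $\int_T d\psi_l\ne0$ for at least one $l$, then there are also some $\hat\alpha\in(0,\alpha)$ and $N_1^0,N_2^0$, not depending on the decision problem, for which all of this holds with $\bigl|\int_T d\psi_l\bigr|$ in place of $\int_T|d\psi_l|$. -/

import Mathlib

open Set Filter Topology MeasureTheory

noncomputable section

namespace BiUtility

/-! ### Utility functions on a rectangle -/

/-- A nondegenerate closed rectangle `T = [xlo, xhi] × [ylo, yhi]`. -/
structure Rect where
  xlo : ℝ
  xhi : ℝ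
  ylo : ℝ
  yhi : ℝ
  hx : xlo < xhi
  hy : ylo < yhi

/-- The rectangle as a subset of the plane. -/
def Rect.carrier (T : Rect) : Set (ℝ × ℝ) := Icc T.xlo T.xhi ×ˢ Icc T.ylo T.yhi

/-- The conservative property (multivariate risk aversion) on `T`. -/
def Conservative (T : Rect) (u : ℝ × ℝ → ℝ) : Prop :=
  ∀ x ∈ Icc T.xlo T.xhi, ∀ x' ∈ Icc T.xlo T.xhi, ∀ y ∈ Icc T.ylo T.yhi, ∀ y' ∈ Icc T.ylo T.yhi,
    x < x' → y < y' → u (x, y) + u (x', y') ≤ u (x, y') + u (x', y)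

/-- The class of utility functions: continuous, componentwise non-decreasing functions `T → [0,1]`,
normalized at the two extreme corners, conservative, and Lipschitz with modulus `L` for the
`ℓ¹`-norm. Only the values on `T` matter. (`MonotoneOn` is for the componentwise order.) -/
structure IsUtility (T : Rect) (L : ℝ) (u : ℝ × ℝ → ℝ) : Prop where
  continuousOn : ContinuousOn u T.carrier
  mapsTo : MapsTo u T.carrier (Icc 0 1)
  monotoneOn : MonotoneOn u T.carrier
  lo : u (T.xlo, T.ylo) = 0
  hi : u (T.xhi, T.yhi) = 1
  conservative : Conservative T u
  lipschitz : ∀ p ∈ T.carrier, ∀ q ∈ T.carrier,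
    |u p - u q| ≤ L * (|p.1 - q.1| + |p.2 - q.2|)

/-! ### Lebesgue–Stieltjes integrals -/

/-- The mixed increment of `ψ` over `[a, b] × [c, d]`. -/
def increment (ψ : ℝ × ℝ → ℝ) (a b c d : ℝ) : ℝ := ψ (b, d) - ψ (a, d) - ψ (b, c) + ψ (a, c)

/-- `μ` is, on `T`, the (finite signed) Lebesgue–Stieltjes measure `dψ`: the mass of each closed
rectangle in `T` is the limit of the increments of `ψ` over shrinking neighbourhoods of it.
No one-sided continuity of `ψ` is needed. If `ψ` is given on `T` only, then it is to be extended: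
constantly in each variable beyond `T`, or by zero if it is the distribution function of
a signed measure carried by `T`. -/
def IsLSMeasure (T : Rect) (ψ : ℝ × ℝ → ℝ) (μ : SignedMeasure (ℝ × ℝ)) : Prop :=
  ∀ a b c d : ℝ, T.xlo ≤ a → a ≤ b → b ≤ T.xhi → T.ylo ≤ c → c ≤ d → d ≤ T.yhi →
    Tendsto (fun ε : ℝ => increment ψ (a - ε) (b + ε) (c - ε) (d + ε)) (𝓝[>] 0)
      (𝓝 (μ (Icc a b ×ˢ Icc c d)))

/-- `∫_T u dμ` for a finite signed measure `μ`. -/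
def signedIntegral (T : Rect) (μ : SignedMeasure (ℝ × ℝ)) (u : ℝ × ℝ → ℝ) : ℝ :=
  (∫ p in T.carrier, u p ∂μ.toJordanDecomposition.posPart) -
    ∫ p in T.carrier, u p ∂μ.toJordanDecomposition.negPart

/-- `∫_T |dμ|`, the total variation of `μ` on `T`. -/
def variationOn (T : Rect) (μ : SignedMeasure (ℝ × ℝ)) : ℝ :=
  (μ.totalVariation T.carrier).toReal

/-! ### The ambiguity set and Slater's condition -/

/-- The ambiguity set: utilities `u` with `∫_T u dμ_l ≤ c_l` for all `l`. -/
def ambiguitySet (T : Rect) (L : ℝ) {M : ℕ} (μ : Fin M → SignedMeasure (ℝ × ℝ)) (c : Fin M → ℝ) :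
    Set (ℝ × ℝ → ℝ) :=
  {u | IsUtility T L u ∧ ∀ l, signedIntegral T (μ l) u ≤ c l}

/-- Slater's condition with constant `α` at `u₀`: the vector `(∫_T u₀ dμ_l - c_l)_l` plus `α` times
the Euclidean unit ball lies in the nonpositive orthant. -/
def Slater (T : Rect) {M : ℕ} (μ : Fin M → SignedMeasure (ℝ × ℝ)) (c : Fin M → ℝ)
    (α : ℝ) (u₀ : ℝ × ℝ → ℝ) : Prop :=
  ∀ w : EuclideanSpace ℝ (Fin M), ‖w‖ ≤ 1 → ∀ l, signedIntegral T (μ l) u₀ - c l + α * w l ≤ 0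

/-! ### Grids and piecewise linear utilities -/

/-- `x 1 < x 2 < … < x n` is a grid of `n ≥ 2` points from `a` to `b`. -/
structure IsGrid (a b : ℝ) (n : ℕ) (x : ℕ → ℝ) : Prop where
  two_le : 2 ≤ n
  first : x 1 = a
  last : x n = b
  strictMonoOn : StrictMonoOn x (Icc 1 n)

/-- The mesh size `max_{1 ≤ i < n} (x (i+1) - x i)`. -/
def mesh (n : ℕ) (x : ℕ → ℝ) : ℝ := sSup ((fun i => x (i + 1) - x i) '' Ico 1 n)

/-- Which diagonal of each cell is used: `type1` is the main diagonal,
`type2` the counter diagonal. -/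
inductive PLAType
  | type1
  | type2

/-- The piecewise linear function on a cell with values `u₀₀, u₁₀, u₀₁, u₁₁` at its vertices (first
index: `x`), at the point with relative coordinates `s, t ∈ [0,1]`. -/
def cellInterp : PLAType → (u₀₀ u₁₀ u₀₁ u₁₁ s t : ℝ) → ℝ
  | .type1, u₀₀, u₁₀, u₀₁, u₁₁, s, t =>
      if s ≤ t then (1 - t) * u₀₀ + (t - s) * u₀₁ + s * u₁₁
      else (1 - s) * u₀₀ + (s - t) * u₁₀ + t * u₁₁
  | .type2, u₀₀, u₁₀, u₀₁, u₁₁, s, t =>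
      if 1 ≤ s + t then (1 - s) * u₀₁ + (s - (1 - t)) * u₁₁ + (1 - t) * u₁₀
      else t * u₀₁ + ((1 - s) - t) * u₀₀ + s * u₁₀

/-- `u` is piecewise linear of the given type: on each (closed) cell it is the interpolant of its
own values at the four vertices. -/
def IsPiecewiseLinear (k : PLAType) (n₁ : ℕ) (x : ℕ → ℝ) (n₂ : ℕ) (y : ℕ → ℝ)
    (u : ℝ × ℝ → ℝ) : Prop :=
  ∀ i ∈ Ico 1 n₁, ∀ j ∈ Ico 1 n₂, ∀ p ∈ Icc (x i) (x (i + 1)) ×ˢ Icc (y j) (y (j + 1)),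
    u p = cellInterp k (u (x i, y j)) (u (x (i + 1), y j)) (u (x i, y (j + 1)))
      (u (x (i + 1), y (j + 1)))
      ((p.1 - x i) / (x (i + 1) - x i)) ((p.2 - y j) / (y (j + 1) - y j))

/-- The ambiguity set of piecewise linear utilities. -/
def ambiguitySetN (T : Rect) (L : ℝ) {M : ℕ} (μ : Fin M → SignedMeasure (ℝ × ℝ)) (c : Fin M → ℝ)
    (k : PLAType) (n₁ : ℕ) (x : ℕ → ℝ) (n₂ : ℕ) (y : ℕ → ℝ) : Set (ℝ × ℝ → ℝ) :=
  {u | u ∈ ambiguitySet T L μ c ∧ IsPiecewiseLinear k n₁ x n₂ y u}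

/-! ### The maximin problem -/

/-- Data of the decision problem: a nonempty compact convex feasible set `Z ⊆ ℝⁿ`, the law `P` of
the random vector, carried by a compact set `Ξ ⊆ ℝᵐ`, and a continuous reward function
`f : ℝⁿ × ℝᵐ → ℝ²` taking values in `T` on `Z × Ξ`. -/
structure DecisionProblem (T : Rect) (n m : ℕ) where
  Z : Set (EuclideanSpace ℝ (Fin n))
  Z_nonempty : Z.Nonempty
  Z_compact : IsCompact Z
  Z_convex : Convex ℝ Z
  Ξ : Set (EuclideanSpace ℝ (Fin m))
  Ξ_compact : IsCompact Ξ
  P : Measure (EuclideanSpace ℝ (Fin m))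
  P_prob : IsProbabilityMeasure P
  P_supp : P Ξᶜ = 0
  f : EuclideanSpace ℝ (Fin n) × EuclideanSpace ℝ (Fin m) → ℝ × ℝ
  f_cont : Continuous f
  f_mem : ∀ z ∈ Z, ∀ ξ ∈ Ξ, f (z, ξ) ∈ T.carrier

namespace DecisionProblem

variable {T : Rect} {n m : ℕ} (D : DecisionProblem T n m) (U : Set (ℝ × ℝ → ℝ))

/-- The expected utility `E_P[u(f(z, ξ))]`. -/
def expectedUtility (u : ℝ × ℝ → ℝ) (z : EuclideanSpace ℝ (Fin n)) : ℝ :=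
  ∫ ξ, u (D.f (z, ξ)) ∂D.P

/-- The robust objective: the worst-case expected utility over `U`. -/
def robust (z : EuclideanSpace ℝ (Fin n)) : ℝ := sInf ((fun u => D.expectedUtility u z) '' U)

/-- The optimal value of the maximin problem. -/
def optVal : ℝ := sSup (D.robust U '' D.Z)

/-- The set of optimal solutions of the maximin problem. -/
def optSet : Set (EuclideanSpace ℝ (Fin n)) := {z ∈ D.Z | IsMaxOn (D.robust U) D.Z z}

/-- The growth function of the robust objective,
`Λ(τ) = inf {ϑ - v(z) : z ∈ Z, d(z, Z*) ≥ τ}`, with value `+∞` if there is no such `z`. -/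
def growth (τ : ℝ) : EReal :=
  ⨅ z ∈ {z ∈ D.Z | τ ≤ Metric.infDist z (D.optSet U)}, ((D.optVal U - D.robust U z : ℝ) : EReal)

/-- The generalized inverse `Λ⁻¹(η) = sup {τ : Λ(τ) ≤ η}` of the growth function. -/
def growthInv (η : ℝ) : ℝ := sSup {τ : ℝ | D.growth U τ ≤ (η : EReal)}

end DecisionProblem

/-- The deviation `sup_{z ∈ A} inf_{z' ∈ B} ‖z - z'‖` of `A` from `B`. -/
def deviation {n : ℕ} (A B : Set (EuclideanSpace ℝ (Fin n))) : ℝ :=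
  sSup ((fun z => Metric.infDist z B) '' A)

/-- The error bounds with factor `κ`: for all sufficiently fine grids of the two families (how fine
does not depend on the decision problem) the piecewise linear ambiguity set is nonempty and, for
every decision problem, both maximin problems have solutions, the optimal values differ by at most
`L (β₁ + β₂) κ`, and the deviation of the approximate from the true set of optimal solutions is
at most `Λ⁻¹(2 L (β₁ + β₂) κ)`. -/
def ErrorBounds (T : Rect) (L : ℝ) {M : ℕ} (μ : Fin M → SignedMeasure (ℝ × ℝ)) (c : Fin M → ℝ)
    (k : PLAType) (x y : ℕ → ℕ → ℝ) (κ : ℝ) : Prop :=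
  ∃ N₁₀ N₂₀ : ℕ, ∀ N₁ N₂ : ℕ, N₁₀ ≤ N₁ → N₂₀ ≤ N₂ →
    (ambiguitySetN T L μ c k N₁ (x N₁) N₂ (y N₂)).Nonempty ∧
    ∀ (n m : ℕ) (D : DecisionProblem T n m),
      (D.optSet (ambiguitySet T L μ c)).Nonempty ∧
      (D.optSet (ambiguitySetN T L μ c k N₁ (x N₁) N₂ (y N₂))).Nonempty ∧
      |D.optVal (ambiguitySetN T L μ c k N₁ (x N₁) N₂ (y N₂)) - D.optVal (ambiguitySet T L μ c)| ≤
        L * (mesh N₁ (x N₁) + mesh N₂ (y N₂)) * κ ∧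
      deviation (D.optSet (ambiguitySetN T L μ c k N₁ (x N₁) N₂ (y N₂)))
          (D.optSet (ambiguitySet T L μ c)) ≤
        D.growthInv (ambiguitySet T L μ c) (2 * (L * (mesh N₁ (x N₁) + mesh N₂ (y N₂)) * κ))

end BiUtility

end

/-! The piecewise linear utilities in the ambiguity set are uniformly dense in it, with an explicit
error. Put `ε = L * (β₁ + β₂)`, with `β₁`, `β₂` the mesh sizes, and let `V` be the Euclidean norm of
the vector of total variations.

Interpolating a utility at the grid nodes gives a utility with the same `L`
(`IsUtility.gridInterp`), within `ε` of the original (`IsUtility.abs_gridInterp_sub_le`). Writing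
the interpolant by one global formula in clamped coordinates makes this visible: its mixed
increments are sums of nodal increments, which are nonpositive, times increments of a 2-increasing
kernel; its increments in one variable are nonnegative combinations of nodal ones.

Interpolation may violate each integral constraint by up to `ε * V`. Mixing in the interpolant of
the Slater point with weight `ε * V / α` restores feasibility and moves the function by at most that
weight, so the total error is `ε * (1 + V / α)` (`exists_mem_ambiguitySetN`).

A uniformly dense subset changes worst-case expectations, hence optimal values, by at most the same
error, and its maximizers are nearly optimal for the full problem, so the growth function controls
their distance to the true solutions (`errorBounds_of_dense`). Any factor of at least `1 + V / α`
therefore works; both claims are instances of this. -/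

namespace BiUtility

/-! ### One-dimensional grids -/

section Grid

variable {a b : ℝ} {n : ℕ} {x : ℕ → ℝ}

lemma IsGrid.lt_succ (hx : IsGrid a b n x) {i : ℕ} (hi : i ∈ Ico 1 n) : x i < x (i + 1) := by
  obtain ⟨h1, h2⟩ := hi
  exact hx.strictMonoOn ⟨h1, h2.le⟩ ⟨by omega, h2⟩ (Nat.lt_succ_self i)

lemma IsGrid.mem_Icc (hx : IsGrid a b n x) {i : ℕ} (h1 : 1 ≤ i) (h2 : i ≤ n) :
    x i ∈ Icc a b := by
  have hn := hx.two_le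
  constructor
  · rw [← hx.first]
    exact hx.strictMonoOn.monotoneOn ⟨le_rfl, by omega⟩ ⟨h1, h2⟩ h1
  · rw [← hx.last]
    exact hx.strictMonoOn.monotoneOn ⟨h1, h2⟩ ⟨by omega, le_rfl⟩ h2

lemma sub_le_mesh {i : ℕ} (hi : i ∈ Ico 1 n) : x (i + 1) - x i ≤ mesh n x :=
  le_csSup ((finite_Ico 1 n).image _).bddAbove (mem_image_of_mem (fun i => x (i + 1) - x i) hi)

lemma IsGrid.mesh_nonneg (hx : IsGrid a b n x) : 0 ≤ mesh n x := by
  have h : 1 ∈ Ico 1 n := ⟨le_rfl, hx.two_le⟩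
  linarith [sub_le_mesh (x := x) h, hx.lt_succ h]

lemma IsGrid.exists_cell (hx : IsGrid a b n x) {t : ℝ} (ht : t ∈ Icc a b) :
    ∃ i ∈ Ico 1 n, t ∈ Icc (x i) (x (i + 1)) := by
  have key : ∀ m, 2 ≤ m → x 1 ≤ t → t ≤ x m → ∃ i ∈ Ico 1 m, t ∈ Icc (x i) (x (i + 1)) := by
    intro m hm h1
    induction m, hm using Nat.le_induction with
    | base => exact fun h2 => ⟨1, ⟨le_rfl, by norm_num⟩, h1, h2⟩
    | succ m hm ih =>
      intro h2
      rcases le_total t (x m) with h | h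
      · obtain ⟨i, hi, hit⟩ := ih h
        exact ⟨i, ⟨hi.1, hi.2.trans (Nat.lt_succ_self m)⟩, hit⟩
      · exact ⟨m, ⟨by omega, Nat.lt_succ_self m⟩, h, h2⟩
  exact key n hx.two_le (hx.first ▸ ht.1) (hx.last ▸ ht.2)

/-- The relative position of `t` in the interval `[x i, x (i + 1)]`, clamped to `[0, 1]`. -/
noncomputable def ramp (x : ℕ → ℝ) (i : ℕ) (t : ℝ) : ℝ :=
  max 0 (min 1 ((t - x i) / (x (i + 1) - x i)))

lemma ramp_mem (x : ℕ → ℝ) (i : ℕ) (t : ℝ) : ramp x i t ∈ Icc (0 : ℝ) 1 :=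
  ⟨le_max_left _ _, max_le zero_le_one (min_le_left _ _)⟩

lemma ramp_mono {i : ℕ} (h : x i < x (i + 1)) : Monotone (ramp x i) := by
  intro s t hst
  have := sub_pos.2 h
  unfold ramp
  gcongr

lemma continuous_ramp (x : ℕ → ℝ) (i : ℕ) : Continuous (ramp x i) := by
  unfold ramp
  fun_prop

lemma ramp_eq {i : ℕ} (h : x i < x (i + 1)) {t : ℝ} (ht : t ∈ Icc (x i) (x (i + 1))) :
    ramp x i t = (t - x i) / (x (i + 1) - x i) := by
  have := sub_pos.2 h
  rw [ramp, min_eq_right, max_eq_right]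
  · exact div_nonneg (sub_nonneg.2 ht.1) this.le
  · rw [div_le_one this]
    linarith [ht.2]

lemma ramp_eq_zero {i : ℕ} (h : x i < x (i + 1)) {t : ℝ} (ht : t ≤ x i) : ramp x i t = 0 := by
  have := sub_pos.2 h
  refine max_eq_left ((min_le_right _ _).trans ?_)
  exact div_nonpos_of_nonpos_of_nonneg (by linarith) this.le

lemma ramp_eq_one {i : ℕ} (h : x i < x (i + 1)) {t : ℝ} (ht : x (i + 1) ≤ t) :
    ramp x i t = 1 := by
  have := sub_pos.2 h
  rw [ramp, min_eq_left, max_eq_right zero_le_one]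
  rw [one_le_div this]
  linarith

/-- Cells to the left of `t` have ramp 1 and cells to the right have ramp 0, so only cell `I` keeps
a variable term. Every local evaluation of the global interpolation formula rests on this collapse.
-/
lemma IsGrid.sum_ramp (hx : IsGrid a b n x) {I : ℕ} (hI : I ∈ Ico 1 n) {t : ℝ}
    (ht : t ∈ Icc (x I) (x (I + 1))) (g : ℕ → ℝ → ℝ) (hg : ∀ i, g i 0 = 0) :
    ∑ i ∈ Finset.Ico 1 n, g i (ramp x i t) =
      ∑ i ∈ Finset.Ico 1 I, g i 1 + g I (ramp x I t) := by
  obtain ⟨h1, h2⟩ := hI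
  rw [← Finset.sum_Ico_consecutive _ h1 h2.le, Finset.sum_eq_sum_Ico_succ_bot h2]
  have hlow : ∀ i ∈ Finset.Ico 1 I, g i (ramp x i t) = g i 1 := by
    intro i hi
    rw [Finset.mem_Ico] at hi
    rw [ramp_eq_one (hx.lt_succ ⟨hi.1, hi.2.trans h2⟩)]
    exact (hx.strictMonoOn.monotoneOn ⟨by omega, by omega⟩ ⟨h1, h2.le⟩ hi.2).trans ht.1
  have hhigh : ∀ i ∈ Finset.Ico (I + 1) n, g i (ramp x i t) = 0 := by
    intro i hi
    rw [Finset.mem_Ico] at hi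
    rw [ramp_eq_zero (hx.lt_succ ⟨by omega, hi.2⟩), hg]
    exact ht.2.trans
      (hx.strictMonoOn.monotoneOn ⟨by omega, by omega⟩ ⟨by omega, hi.2.le⟩ hi.1)
  rw [Finset.sum_congr rfl hlow, Finset.sum_eq_zero hhigh, add_zero]

lemma sum_Ico_one_sub (g : ℕ → ℝ) {I : ℕ} (hI : 1 ≤ I) :
    ∑ i ∈ Finset.Ico 1 I, (g (i + 1) - g i) = g I - g 1 := by
  induction I, hI using Nat.le_induction with
  | base => simp
  | succ m hm ih => rw [Finset.sum_Ico_succ_top hm, ih]; ring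

/-- Splits a length into its parts in the cells, so that a Lipschitz bound can be checked cell by
cell. -/
lemma IsGrid.sum_length_mul_ramp (hx : IsGrid a b n x) {t : ℝ} (ht : t ∈ Icc a b) :
    ∑ i ∈ Finset.Ico 1 n, (x (i + 1) - x i) * ramp x i t = t - a := by
  obtain ⟨I, hI, hIt⟩ := hx.exists_cell ht
  have h := hx.lt_succ hI
  rw [hx.sum_ramp hI hIt (fun i s => (x (i + 1) - x i) * s) (fun i => mul_zero _)]
  simp only [mul_one]
  rw [sum_Ico_one_sub _ hI.1, ramp_eq h hIt, mul_div_cancel₀ _ (sub_pos.2 h).ne', hx.first]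
  ring

end Grid

/-! ### The interpolation kernel of a cell -/

/-- The coefficient of the mixed increment in the interpolant on the unit cell. -/
noncomputable def kernel : PLAType → ℝ → ℝ → ℝ
  | .type1, s, t => min s t
  | .type2, s, t => max (s + t - 1) 0

section Kernel

variable (k : PLAType) {s s' t t' : ℝ}

lemma kernel_comm (s t : ℝ) : kernel k s t = kernel k t s := by
  cases k
  · exact min_comm s t
  · simp only [kernel, add_comm]

lemma kernel_zero_left (ht : t ∈ Icc (0 : ℝ) 1) : kernel k 0 t = 0 := by
  cases k
  · exact min_eq_left ht.1
  · exact max_eq_right (by linarith [ht.2])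

lemma kernel_zero_right (ht : t ∈ Icc (0 : ℝ) 1) : kernel k t 0 = 0 := by
  rw [kernel_comm, kernel_zero_left k ht]

lemma kernel_one_left (ht : t ∈ Icc (0 : ℝ) 1) : kernel k 1 t = t := by
  cases k
  · exact min_eq_right ht.2
  · exact (max_eq_left (by linarith [ht.1])).trans (by ring)

lemma kernel_one_right (ht : t ∈ Icc (0 : ℝ) 1) : kernel k t 1 = t := by
  rw [kernel_comm, kernel_one_left k ht]

lemma continuous_kernel : Continuous fun p : ℝ × ℝ => kernel k p.1 p.2 := by
  cases k <;> simp only [kernel] <;> fun_prop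

lemma kernel_sub_mem (hs : s ≤ s') (t : ℝ) :
    kernel k s' t - kernel k s t ∈ Icc 0 (s' - s) := by
  cases k <;> simp only [kernel, mem_Icc] <;> grind

/-- The two kernels are the upper and lower Fréchet–Hoeffding copulas, and copulas are 2-increasing.
-/
lemma kernel_increment_nonneg (hs : s ≤ s') (ht : t ≤ t') :
    0 ≤ kernel k s' t' - kernel k s' t - kernel k s t' + kernel k s t := by
  cases k <;> simp only [kernel] <;> grind

/-- Both types share the same affine part and differ only in how the mixed increment is spread over
the cell. -/
lemma cellInterp_eq (u₀₀ u₁₀ u₀₁ u₁₁ s t : ℝ) :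
    cellInterp k u₀₀ u₁₀ u₀₁ u₁₁ s t =
      u₀₀ + s * (u₁₀ - u₀₀) + t * (u₀₁ - u₀₀) + (u₁₁ - u₁₀ - u₀₁ + u₀₀) * kernel k s t := by
  cases k <;> simp only [cellInterp, kernel] <;> split_ifs with h
  · rw [min_eq_left h]; ring
  · rw [min_eq_right (le_of_not_ge h)]; ring
  · rw [max_eq_left (by linarith)]; ring
  · rw [max_eq_right (by linarith)]; ring

/-- On each triangle the interpolant is a convex combination of three vertex values. -/
lemma abs_cellInterp_sub_le {u₀₀ u₁₀ u₀₁ u₁₁ v ε : ℝ} (hs : s ∈ Icc (0 : ℝ) 1)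
    (ht : t ∈ Icc (0 : ℝ) 1) (h₀₀ : |u₀₀ - v| ≤ ε) (h₁₀ : |u₁₀ - v| ≤ ε) (h₀₁ : |u₀₁ - v| ≤ ε)
    (h₁₁ : |u₁₁ - v| ≤ ε) : |cellInterp k u₀₀ u₁₀ u₀₁ u₁₁ s t - v| ≤ ε := by
  have comb : ∀ {p q r A B C : ℝ}, 0 ≤ p → 0 ≤ q → 0 ≤ r → p + q + r = 1 →
      |A - v| ≤ ε → |B - v| ≤ ε → |C - v| ≤ ε → |p * A + q * B + r * C - v| ≤ ε := by
    intro p q r A B C hp hq hr h hA hB hC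
    rw [abs_le] at *
    have e : p * A + q * B + r * C - v = p * (A - v) + q * (B - v) + r * (C - v) := by
      linear_combination v * h
    have e2 : ε = p * ε + q * ε + r * ε := by linear_combination (-ε) * h
    rw [e]
    constructor
    · have := mul_le_mul_of_nonneg_left hA.1 hp
      have := mul_le_mul_of_nonneg_left hB.1 hq
      have := mul_le_mul_of_nonneg_left hC.1 hr
      linarith
    · have := mul_le_mul_of_nonneg_left hA.2 hp
      have := mul_le_mul_of_nonneg_left hB.2 hq
      have := mul_le_mul_of_nonneg_left hC.2 hr
      linarith
  obtain ⟨hs0, hs1⟩ := hs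
  obtain ⟨ht0, ht1⟩ := ht
  cases k <;> simp only [cellInterp] <;> split_ifs with h <;>
    exact comb (by linarith) (by linarith) (by linarith) (by ring) (by assumption)
      (by assumption) (by assumption)

end Kernel

/-! ### The piecewise linear interpolant on a grid -/

/-- The piecewise linear interpolant of `u` on the product grid. -/
noncomputable def gridInterp (k : PLAType) (n : ℕ) (x : ℕ → ℝ) (m : ℕ) (y : ℕ → ℝ)
    (u : ℝ × ℝ → ℝ) (p : ℝ × ℝ) : ℝ :=
  u (x 1, y 1) + ∑ i ∈ Finset.Ico 1 n, ramp x i p.1 * (u (x (i + 1), y 1) - u (x i, y 1)) +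
    ∑ j ∈ Finset.Ico 1 m, ramp y j p.2 * (u (x 1, y (j + 1)) - u (x 1, y j)) +
    ∑ i ∈ Finset.Ico 1 n, ∑ j ∈ Finset.Ico 1 m,
      increment u (x i) (x (i + 1)) (y j) (y (j + 1)) * kernel k (ramp x i p.1) (ramp y j p.2)

section Interp

variable (k : PLAType) {T : Rect} {L : ℝ} {n m : ℕ} {x y : ℕ → ℝ} {u : ℝ × ℝ → ℝ}

/-- Since the kernel is symmetric, estimates in the first variable transfer to the second. -/
lemma gridInterp_swap (p : ℝ × ℝ) :
    gridInterp k n x m y u p = gridInterp k m y n x (u ∘ Prod.swap) p.swap := by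
  have h : ∑ i ∈ Finset.Ico 1 n, ∑ j ∈ Finset.Ico 1 m,
      increment u (x i) (x (i + 1)) (y j) (y (j + 1)) * kernel k (ramp x i p.1) (ramp y j p.2) =
      ∑ j ∈ Finset.Ico 1 m, ∑ i ∈ Finset.Ico 1 n,
        increment (u ∘ Prod.swap) (y j) (y (j + 1)) (x i) (x (i + 1)) *
          kernel k (ramp y j p.2) (ramp x i p.1) := by
    rw [Finset.sum_comm]
    refine Finset.sum_congr rfl fun j _ => Finset.sum_congr rfl fun i _ => ?_
    rw [kernel_comm]
    simp only [increment, Function.comp, Prod.swap]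
    ring
  rw [gridInterp, gridInterp, h]
  simp only [Function.comp, Prod.swap]
  ring

/-- Rows below `J` enter with `kernel k s 1 = s`, so their mixed increments telescope and lift the
bottom-edge differences from level `y 1` to level `y J`. -/
lemma gridInterp_row {c d : ℝ} (hy : IsGrid c d m y) {J : ℕ} (hJ : J ∈ Ico 1 m) {p : ℝ × ℝ}
    (hp : p.2 ∈ Icc (y J) (y (J + 1))) :
    gridInterp k n x m y u p =
      u (x 1, y J) + ramp y J p.2 * (u (x 1, y (J + 1)) - u (x 1, y J)) +
        ∑ i ∈ Finset.Ico 1 n, (ramp x i p.1 * (u (x (i + 1), y J) - u (x i, y J)) +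
          increment u (x i) (x (i + 1)) (y J) (y (J + 1)) *
            kernel k (ramp x i p.1) (ramp y J p.2)) := by
  have h1 := hy.sum_ramp hJ hp (fun j s => s * (u (x 1, y (j + 1)) - u (x 1, y j)))
    (fun j => zero_mul _)
  simp only [one_mul] at h1
  rw [sum_Ico_one_sub (fun j => u (x 1, y j)) hJ.1] at h1
  have h2 : ∀ i, ∑ j ∈ Finset.Ico 1 m, increment u (x i) (x (i + 1)) (y j) (y (j + 1)) *
      kernel k (ramp x i p.1) (ramp y j p.2) =
      ramp x i p.1 * (u (x (i + 1), y J) - u (x i, y J)) -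
        ramp x i p.1 * (u (x (i + 1), y 1) - u (x i, y 1)) +
        increment u (x i) (x (i + 1)) (y J) (y (J + 1)) *
          kernel k (ramp x i p.1) (ramp y J p.2) := by
    intro i
    rw [hy.sum_ramp hJ hp (fun j s => increment u (x i) (x (i + 1)) (y j) (y (j + 1)) *
      kernel k (ramp x i p.1) s) fun j => by
        simp only [kernel_zero_right k (ramp_mem x i p.1), mul_zero]]
    have h3 := sum_Ico_one_sub (fun j => u (x (i + 1), y j) - u (x i, y j)) hJ.1
    have h4 : ∀ j, increment u (x i) (x (i + 1)) (y j) (y (j + 1)) =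
        u (x (i + 1), y (j + 1)) - u (x i, y (j + 1)) - (u (x (i + 1), y j) - u (x i, y j)) := by
      intro j
      rw [increment]
      ring
    rw [← Finset.sum_mul, kernel_one_right k (ramp_mem x i p.1), Finset.sum_congr rfl
      fun j _ => h4 j, h3]
    ring
  rw [gridInterp, h1, Finset.sum_congr rfl fun i _ => h2 i]
  simp only [Finset.sum_add_distrib, Finset.sum_sub_distrib]
  ring

lemma gridInterp_cell {a b c d : ℝ} (hx : IsGrid a b n x) (hy : IsGrid c d m y) {I J : ℕ}
    (hI : I ∈ Ico 1 n) (hJ : J ∈ Ico 1 m) {p : ℝ × ℝ} (hp1 : p.1 ∈ Icc (x I) (x (I + 1)))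
    (hp2 : p.2 ∈ Icc (y J) (y (J + 1))) :
    gridInterp k n x m y u p =
      cellInterp k (u (x I, y J)) (u (x (I + 1), y J)) (u (x I, y (J + 1)))
        (u (x (I + 1), y (J + 1))) (ramp x I p.1) (ramp y J p.2) := by
  have ht := ramp_mem y J p.2
  rw [gridInterp_row k hy hJ hp2, cellInterp_eq, hx.sum_ramp hI hp1
    (fun i s => s * (u (x (i + 1), y J) - u (x i, y J)) +
      increment u (x i) (x (i + 1)) (y J) (y (J + 1)) * kernel k s (ramp y J p.2))
    fun i => by simp only [kernel_zero_left k ht, mul_zero, zero_mul, add_zero]]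
  have h := sum_Ico_one_sub
    (fun i => (1 - ramp y J p.2) * u (x i, y J) + ramp y J p.2 * u (x i, y (J + 1))) hI.1
  rw [Finset.sum_congr rfl (g := fun i => (1 - ramp y J p.2) * u (x (i + 1), y J) +
    ramp y J p.2 * u (x (i + 1), y (J + 1)) -
    ((1 - ramp y J p.2) * u (x i, y J) + ramp y J p.2 * u (x i, y (J + 1)))), h]
  · rw [increment]
    ring
  · intro i _
    rw [kernel_one_left k ht, increment]
    ring

lemma gridInterp_node {a b c d : ℝ} (hx : IsGrid a b n x) (hy : IsGrid c d m y) {i j : ℕ}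
    (hi : i ∈ Icc 1 n) (hj : j ∈ Icc 1 m) :
    gridInterp k n x m y u (x i, y j) = u (x i, y j) := by
  -- A node is the left end of its own cell, except the last node, which is the right end of the
  -- last cell.
  have key : ∀ {a b : ℝ} {n : ℕ} {x : ℕ → ℝ}, IsGrid a b n x → ∀ i ∈ Icc 1 n, ∃ I ∈ Ico 1 n,
      x i ∈ Icc (x I) (x (I + 1)) ∧
        ((i = I ∧ ramp x I (x i) = 0) ∨ (i = I + 1 ∧ ramp x I (x i) = 1)) := by
    intro a b n x hx i hi
    have hn := hx.two_le
    obtain ⟨h1, h2⟩ := hi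
    rcases h2.lt_or_eq with h | rfl
    · have hlt := hx.lt_succ ⟨h1, h⟩
      exact ⟨i, ⟨h1, h⟩, ⟨le_rfl, hlt.le⟩, .inl ⟨rfl, ramp_eq_zero hlt le_rfl⟩⟩
    · obtain ⟨I, rfl⟩ : ∃ I, i = I + 1 := ⟨i - 1, by omega⟩
      have hI : I ∈ Ico 1 (I + 1) := ⟨by omega, by omega⟩
      have hlt := hx.lt_succ hI
      exact ⟨I, hI, ⟨hlt.le, le_rfl⟩, .inr ⟨rfl, ramp_eq_one hlt le_rfl⟩⟩
  obtain ⟨I, hI, hxI, hi'⟩ := key hx i hi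
  obtain ⟨J, hJ, hyJ, hj'⟩ := key hy j hj
  rw [gridInterp_cell k hx hy hI hJ hxI hyJ, cellInterp_eq]
  have h0 : (0 : ℝ) ∈ Icc (0 : ℝ) 1 := ⟨le_rfl, zero_le_one⟩
  have h1 : (1 : ℝ) ∈ Icc (0 : ℝ) 1 := ⟨zero_le_one, le_rfl⟩
  rcases hi' with ⟨rfl, e⟩ | ⟨rfl, e⟩ <;> rcases hj' with ⟨rfl, e'⟩ | ⟨rfl, e'⟩ <;>
    simp only [e, e', kernel_zero_left k h0, kernel_zero_left k h1, kernel_one_left k h0,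
      kernel_one_left k h1] <;> ring

lemma isPiecewiseLinear_gridInterp {a b c d : ℝ} (hx : IsGrid a b n x) (hy : IsGrid c d m y) :
    IsPiecewiseLinear k n x m y (gridInterp k n x m y u) := by
  intro i hi j hj p hp
  have hi0 : i ∈ Icc 1 n := ⟨hi.1, hi.2.le⟩
  have hi1 : i + 1 ∈ Icc 1 n := ⟨by omega, hi.2⟩
  have hj0 : j ∈ Icc 1 m := ⟨hj.1, hj.2.le⟩
  have hj1 : j + 1 ∈ Icc 1 m := ⟨by omega, hj.2⟩
  rw [gridInterp_node k hx hy hi0 hj0, gridInterp_node k hx hy hi0 hj1,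
    gridInterp_node k hx hy hi1 hj0, gridInterp_node k hx hy hi1 hj1,
    ← ramp_eq (hx.lt_succ hi) hp.1, ← ramp_eq (hy.lt_succ hj) hp.2]
  exact gridInterp_cell k hx hy hi hj hp.1 hp.2

lemma continuous_gridInterp : Continuous (gridInterp k n x m y u) := by
  have hk : ∀ i j, Continuous fun p : ℝ × ℝ => kernel k (ramp x i p.1) (ramp y j p.2) :=
    fun i j => (continuous_kernel k).comp
      (((continuous_ramp x i).comp continuous_fst).prodMk
        ((continuous_ramp y j).comp continuous_snd))
  have hr : ∀ i, Continuous fun p : ℝ × ℝ => ramp x i p.1 :=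
    fun i => (continuous_ramp x i).comp continuous_fst
  have hr' : ∀ i, Continuous fun p : ℝ × ℝ => ramp y i p.2 :=
    fun i => (continuous_ramp y i).comp continuous_snd
  unfold gridInterp
  fun_prop

lemma conservative_gridInterp (hx : IsGrid T.xlo T.xhi n x) (hy : IsGrid T.ylo T.yhi m y)
    (hu : Conservative T u) : Conservative T (gridInterp k n x m y u) := by
  intro a ha a' ha' b hb b' hb' haa hbb
  have key : ∑ i ∈ Finset.Ico 1 n, ∑ j ∈ Finset.Ico 1 m,
      increment u (x i) (x (i + 1)) (y j) (y (j + 1)) *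
        (kernel k (ramp x i a') (ramp y j b') - kernel k (ramp x i a') (ramp y j b) -
          kernel k (ramp x i a) (ramp y j b') + kernel k (ramp x i a) (ramp y j b)) ≤ 0 := by
    refine Finset.sum_nonpos fun i hi => Finset.sum_nonpos fun j hj => ?_
    rw [Finset.mem_Ico] at hi hj
    have hxi := hx.lt_succ hi
    have hyj := hy.lt_succ hj
    refine mul_nonpos_of_nonpos_of_nonneg ?_
      (kernel_increment_nonneg k (ramp_mono hxi haa.le) (ramp_mono hyj hbb.le))
    have := hu _ (hx.mem_Icc hi.1 hi.2.le) _ (hx.mem_Icc (by omega) hi.2)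
      _ (hy.mem_Icc hj.1 hj.2.le) _ (hy.mem_Icc (by omega) hj.2) hxi hyj
    rw [increment]
    linarith
  -- The constant and the two edge sums depend on at most one coordinate and cancel in the mixed
  -- increment, leaving the kernel sum.
  simp only [mul_add, mul_sub, Finset.sum_add_distrib, Finset.sum_sub_distrib] at key
  simp only [gridInterp]
  linarith

/-- In the first variable the interpolant is non-decreasing and as Lipschitz as `u`. -/
lemma gridInterp_sub_mem {a b c d : ℝ} (hx : IsGrid a b n x) (hy : IsGrid c d m y)
    (hu : ∀ s ∈ Icc a b, ∀ s' ∈ Icc a b, ∀ t ∈ Icc c d, s ≤ s' →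
      u (s', t) - u (s, t) ∈ Icc 0 (L * (s' - s)))
    {s s' t : ℝ} (hs : s ∈ Icc a b) (hs' : s' ∈ Icc a b) (ht : t ∈ Icc c d) (hss : s ≤ s') :
    gridInterp k n x m y u (s', t) - gridInterp k n x m y u (s, t) ∈ Icc 0 (L * (s' - s)) := by
  obtain ⟨J, hJ, hJt⟩ := hy.exists_cell ht
  have hlen : L * (s' - s) = ∑ i ∈ Finset.Ico 1 n,
      (ramp x i s' - ramp x i s) * (L * (x (i + 1) - x i)) := by
    rw [show s' - s = s' - a - (s - a) by ring, ← hx.sum_length_mul_ramp hs,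
      ← hx.sum_length_mul_ramp hs', ← Finset.sum_sub_distrib, Finset.mul_sum]
    exact Finset.sum_congr rfl fun i _ => by ring
  rw [gridInterp_row k hy hJ hJt, gridInterp_row k hy hJ hJt, add_sub_add_left_eq_sub,
    ← Finset.sum_sub_distrib, hlen]
  have hterm : ∀ i ∈ Finset.Ico 1 n,
      (ramp x i s' * (u (x (i + 1), y J) - u (x i, y J)) +
        increment u (x i) (x (i + 1)) (y J) (y (J + 1)) * kernel k (ramp x i s') (ramp y J t) -
      (ramp x i s * (u (x (i + 1), y J) - u (x i, y J)) +
        increment u (x i) (x (i + 1)) (y J) (y (J + 1)) * kernel k (ramp x i s) (ramp y J t))) ∈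
      Icc 0 ((ramp x i s' - ramp x i s) * (L * (x (i + 1) - x i))) := by
    intro i hi
    rw [Finset.mem_Ico] at hi
    have hxi := hx.lt_succ hi
    have hdiff : ∀ j ∈ Icc 1 m, u (x (i + 1), y j) - u (x i, y j) ∈
        Icc 0 (L * (x (i + 1) - x i)) := fun j hj =>
      hu _ (hx.mem_Icc hi.1 hi.2.le) _ (hx.mem_Icc (by omega) hi.2) _ (hy.mem_Icc hj.1 hj.2) hxi.le
    obtain ⟨hA, hA'⟩ := hdiff J ⟨hJ.1, hJ.2.le⟩
    obtain ⟨hB, hB'⟩ := hdiff (J + 1) ⟨by omega, hJ.2⟩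
    obtain ⟨hθ, hθ'⟩ := kernel_sub_mem k (ramp_mono hxi hss) (ramp y J t)
    set θ := kernel k (ramp x i s') (ramp y J t) - kernel k (ramp x i s) (ramp y J t) with hθdef
    set A := u (x (i + 1), y J) - u (x i, y J) with hAdef
    set B := u (x (i + 1), y (J + 1)) - u (x i, y (J + 1)) with hBdef
    -- The weights of `A` and `B` are nonnegative, because the kernel is monotone and 1-Lipschitz,
    -- and they add up to the ramp increment. Hence the bounds on nodal differences carry over with
    -- the same `L`.
    have e : ramp x i s' * A +
        increment u (x i) (x (i + 1)) (y J) (y (J + 1)) * kernel k (ramp x i s') (ramp y J t) -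
      (ramp x i s * A +
        increment u (x i) (x (i + 1)) (y J) (y (J + 1)) * kernel k (ramp x i s) (ramp y J t)) =
        (ramp x i s' - ramp x i s - θ) * A + θ * B := by
      rw [hθdef, hAdef, hBdef, increment]
      ring
    rw [e]
    have h1 := mul_nonneg (sub_nonneg.2 hθ') hA
    have h2 := mul_nonneg hθ hB
    have h3 := mul_le_mul_of_nonneg_left hA' (sub_nonneg.2 hθ')
    have h4 := mul_le_mul_of_nonneg_left hB' hθ
    exact ⟨by linarith, by linarith⟩
  exact ⟨Finset.sum_nonneg fun i hi => (hterm i hi).1,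
    Finset.sum_le_sum fun i hi => (hterm i hi).2⟩

lemma IsUtility.sub_mem_left (hu : IsUtility T L u) {s s' t : ℝ} (hs : s ∈ Icc T.xlo T.xhi)
    (hs' : s' ∈ Icc T.xlo T.xhi) (ht : t ∈ Icc T.ylo T.yhi) (hss : s ≤ s') :
    u (s', t) - u (s, t) ∈ Icc 0 (L * (s' - s)) := by
  have h1 := hu.monotoneOn (show (s, t) ∈ T.carrier from ⟨hs, ht⟩)
    (show (s', t) ∈ T.carrier from ⟨hs', ht⟩) ⟨hss, le_rfl⟩
  have h2 := hu.lipschitz (s', t) ⟨hs', ht⟩ (s, t) ⟨hs, ht⟩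
  simp only [sub_self, abs_zero, add_zero, abs_of_nonneg (sub_nonneg.2 hss)] at h2
  exact ⟨sub_nonneg.2 h1, (le_abs_self _).trans h2⟩

lemma IsUtility.sub_mem_right (hu : IsUtility T L u) {s t t' : ℝ} (hs : s ∈ Icc T.xlo T.xhi)
    (ht : t ∈ Icc T.ylo T.yhi) (ht' : t' ∈ Icc T.ylo T.yhi) (htt : t ≤ t') :
    u (s, t') - u (s, t) ∈ Icc 0 (L * (t' - t)) := by
  have h1 := hu.monotoneOn (show (s, t) ∈ T.carrier from ⟨hs, ht⟩)
    (show (s, t') ∈ T.carrier from ⟨hs, ht'⟩) ⟨le_rfl, htt⟩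
  have h2 := hu.lipschitz (s, t') ⟨hs, ht'⟩ (s, t) ⟨hs, ht⟩
  simp only [sub_self, abs_zero, zero_add, abs_of_nonneg (sub_nonneg.2 htt)] at h2
  exact ⟨sub_nonneg.2 h1, (le_abs_self _).trans h2⟩

lemma IsUtility.gridInterp (hu : IsUtility T L u) (hx : IsGrid T.xlo T.xhi n x)
    (hy : IsGrid T.ylo T.yhi m y) : IsUtility T L (gridInterp k n x m y u) := by
  have hn := hx.two_le
  have hm := hy.two_le
  set w := BiUtility.gridInterp k n x m y u with hw
  have hleft : ∀ {s s' t : ℝ}, s ∈ Icc T.xlo T.xhi → s' ∈ Icc T.xlo T.xhi →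
      t ∈ Icc T.ylo T.yhi → s ≤ s' → w (s', t) - w (s, t) ∈ Icc 0 (L * (s' - s)) :=
    fun hs hs' ht hss => gridInterp_sub_mem k hx hy
      (fun _ h1 _ h2 _ h3 h4 => hu.sub_mem_left h1 h2 h3 h4) hs hs' ht hss
  have hright : ∀ {s t t' : ℝ}, s ∈ Icc T.xlo T.xhi → t ∈ Icc T.ylo T.yhi →
      t' ∈ Icc T.ylo T.yhi → t ≤ t' → w (s, t') - w (s, t) ∈ Icc 0 (L * (t' - t)) := by
    intro s t t' hs ht ht' htt
    rw [hw, gridInterp_swap k (s, t'), gridInterp_swap k (s, t)]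
    exact gridInterp_sub_mem k hy hx (u := u ∘ Prod.swap)
      (fun _ h1 _ h2 _ h3 h4 => hu.sub_mem_right h3 h1 h2 h4) ht ht' hs htt
  have habs1 : ∀ {s s' t : ℝ}, s ∈ Icc T.xlo T.xhi → s' ∈ Icc T.xlo T.xhi →
      t ∈ Icc T.ylo T.yhi → |w (s, t) - w (s', t)| ≤ L * |s - s'| := by
    intro s s' t hs hs' ht
    rcases le_total s s' with h | h
    · obtain ⟨h1, h2⟩ := hleft hs hs' ht h
      rwa [abs_sub_comm, abs_of_nonneg h1, abs_sub_comm s, abs_of_nonneg (sub_nonneg.2 h)]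
    · obtain ⟨h1, h2⟩ := hleft hs' hs ht h
      rwa [abs_of_nonneg h1, abs_of_nonneg (sub_nonneg.2 h)]
  have habs2 : ∀ {s t t' : ℝ}, s ∈ Icc T.xlo T.xhi → t ∈ Icc T.ylo T.yhi →
      t' ∈ Icc T.ylo T.yhi → |w (s, t) - w (s, t')| ≤ L * |t - t'| := by
    intro s t t' hs ht ht'
    rcases le_total t t' with h | h
    · obtain ⟨h1, h2⟩ := hright hs ht ht' h
      rwa [abs_sub_comm, abs_of_nonneg h1, abs_sub_comm t, abs_of_nonneg (sub_nonneg.2 h)]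
    · obtain ⟨h1, h2⟩ := hright hs ht' ht h
      rwa [abs_of_nonneg h1, abs_of_nonneg (sub_nonneg.2 h)]
  have hmono : MonotoneOn w T.carrier := by
    rintro ⟨s, t⟩ ⟨hs, ht⟩ ⟨s', t'⟩ ⟨hs', ht'⟩ ⟨hss, htt⟩
    have h1 := (hleft hs hs' ht hss).1
    have h2 := (hright hs' ht ht' htt).1
    linarith
  have hlo : w (T.xlo, T.ylo) = 0 := by
    have h := gridInterp_node k (u := u) hx hy (i := 1) (j := 1) ⟨le_rfl, by omega⟩
      ⟨le_rfl, by omega⟩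
    rwa [hx.first, hy.first, hu.lo] at h
  have hhi : w (T.xhi, T.yhi) = 1 := by
    have h := gridInterp_node k (u := u) hx hy (i := n) (j := m) ⟨by omega, le_rfl⟩
      ⟨by omega, le_rfl⟩
    rwa [hx.last, hy.last, hu.hi] at h
  have hloT : (T.xlo, T.ylo) ∈ T.carrier := ⟨⟨le_rfl, T.hx.le⟩, ⟨le_rfl, T.hy.le⟩⟩
  have hhiT : (T.xhi, T.yhi) ∈ T.carrier := ⟨⟨T.hx.le, le_rfl⟩, ⟨T.hy.le, le_rfl⟩⟩
  refine ⟨(continuous_gridInterp k).continuousOn, ?_, hmono, hlo, hhi,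
    conservative_gridInterp k hx hy hu.conservative, ?_⟩
  · intro p hp
    exact ⟨hlo ▸ hmono hloT hp ⟨hp.1.1, hp.2.1⟩, hhi ▸ hmono hp hhiT ⟨hp.1.2, hp.2.2⟩⟩
  · rintro ⟨s, t⟩ ⟨hs, ht⟩ ⟨s', t'⟩ ⟨hs', ht'⟩
    have h1 := habs1 hs hs' ht
    have h2 := habs2 hs' ht ht'
    -- Going through the corner `(s', t)` costs nothing extra in the `ℓ¹`-norm.
    have h3 := abs_sub_le (w (s, t)) (w (s', t)) (w (s', t'))
    rw [mul_add]
    exact h3.trans (add_le_add h1 h2)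

lemma IsUtility.modulus_nonneg (hu : IsUtility T L u) : 0 ≤ L := by
  have h := hu.lipschitz (T.xhi, T.yhi) ⟨⟨T.hx.le, le_rfl⟩, ⟨T.hy.le, le_rfl⟩⟩
    (T.xlo, T.ylo) ⟨⟨le_rfl, T.hx.le⟩, ⟨le_rfl, T.hy.le⟩⟩
  rw [hu.hi, hu.lo, sub_zero, abs_one] at h
  by_contra! hL
  have : 0 ≤ |T.xhi - T.xlo| + |T.yhi - T.ylo| := by positivity
  nlinarith

lemma IsUtility.abs_gridInterp_sub_le (hu : IsUtility T L u) (hx : IsGrid T.xlo T.xhi n x)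
    (hy : IsGrid T.ylo T.yhi m y) {p : ℝ × ℝ} (hp : p ∈ T.carrier) :
    |BiUtility.gridInterp k n x m y u p - u p| ≤ L * (mesh n x + mesh m y) := by
  obtain ⟨I, hI, hp1⟩ := hx.exists_cell hp.1
  obtain ⟨J, hJ, hp2⟩ := hy.exists_cell hp.2
  have key : ∀ i ∈ Icc 1 n, ∀ j ∈ Icc 1 m, x i ∈ Icc (x I) (x (I + 1)) →
      y j ∈ Icc (y J) (y (J + 1)) → |u (x i, y j) - u p| ≤ L * (mesh n x + mesh m y) := by
    intro i hi j hj hxi hyj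
    refine (hu.lipschitz (x i, y j) ⟨hx.mem_Icc hi.1 hi.2, hy.mem_Icc hj.1 hj.2⟩ p hp).trans
      (mul_le_mul_of_nonneg_left (add_le_add ?_ ?_) hu.modulus_nonneg)
    · exact (abs_sub_le_of_le_of_le hxi.1 hxi.2 hp1.1 hp1.2).trans (sub_le_mesh hI)
    · exact (abs_sub_le_of_le_of_le hyj.1 hyj.2 hp2.1 hp2.2).trans (sub_le_mesh hJ)
  have hxlt := (hx.lt_succ hI).le
  have hylt := (hy.lt_succ hJ).le
  have hI0 : I ∈ Icc 1 n := ⟨hI.1, hI.2.le⟩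
  have hI1 : I + 1 ∈ Icc 1 n := ⟨by omega, hI.2⟩
  have hJ0 : J ∈ Icc 1 m := ⟨hJ.1, hJ.2.le⟩
  have hJ1 : J + 1 ∈ Icc 1 m := ⟨by omega, hJ.2⟩
  rw [gridInterp_cell k hx hy hI hJ hp1 hp2]
  exact abs_cellInterp_sub_le k (ramp_mem x I p.1) (ramp_mem y J p.2)
    (key _ hI0 _ hJ0 ⟨le_rfl, hxlt⟩ ⟨le_rfl, hylt⟩) (key _ hI1 _ hJ0 ⟨hxlt, le_rfl⟩ ⟨le_rfl, hylt⟩)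
    (key _ hI0 _ hJ1 ⟨le_rfl, hxlt⟩ ⟨hylt, le_rfl⟩) (key _ hI1 _ hJ1 ⟨hxlt, le_rfl⟩ ⟨hylt, le_rfl⟩)

end Interp

/-! ### Convex combinations in the ambiguity sets -/

section Ambiguity

variable {T : Rect} {L : ℝ} {u v : ℝ × ℝ → ℝ}

lemma Rect.isCompact_carrier (T : Rect) : IsCompact T.carrier := isCompact_Icc.prod isCompact_Icc

lemma IsUtility.convexComb (hu : IsUtility T L u) (hv : IsUtility T L v) {r s : ℝ} (hr : 0 ≤ r)
    (hs : 0 ≤ s) (hrs : r + s = 1) : IsUtility T L (r • u + s • v) where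
  continuousOn := (hu.continuousOn.const_smul r).add (hv.continuousOn.const_smul s)
  mapsTo p hp := convex_Icc (0 : ℝ) 1 (hu.mapsTo hp) (hv.mapsTo hp) hr hs hrs
  monotoneOn p hp q hq hpq := add_le_add
    (mul_le_mul_of_nonneg_left (hu.monotoneOn hp hq hpq) hr)
    (mul_le_mul_of_nonneg_left (hv.monotoneOn hp hq hpq) hs)
  lo := by simp [hu.lo, hv.lo]
  hi := by simp [hu.hi, hv.hi, hrs]
  conservative a ha a' ha' b hb b' hb' haa hbb := by
    have h1 := mul_le_mul_of_nonneg_left (hu.conservative a ha a' ha' b hb b' hb' haa hbb) hr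
    have h2 := mul_le_mul_of_nonneg_left (hv.conservative a ha a' ha' b hb b' hb' haa hbb) hs
    simp only [Pi.add_apply, Pi.smul_apply, smul_eq_mul]
    linarith
  lipschitz p hp q hq := by
    have h1 := mul_le_mul_of_nonneg_left (hu.lipschitz p hp q hq) hr
    have h2 := mul_le_mul_of_nonneg_left (hv.lipschitz p hp q hq) hs
    rw [← abs_of_nonneg hr, ← abs_mul, abs_of_nonneg hr] at h1
    rw [← abs_of_nonneg hs, ← abs_mul, abs_of_nonneg hs] at h2
    have h3 := abs_add_le (r * (u p - u q)) (s * (v p - v q))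
    set D := L * (|p.1 - q.1| + |p.2 - q.2|)
    have h4 : r * D + s * D = D := by rw [← add_mul, hrs, one_mul]
    have h5 : (r • u + s • v) p - (r • u + s • v) q = r * (u p - u q) + s * (v p - v q) := by
      simp only [Pi.add_apply, Pi.smul_apply, smul_eq_mul]
      ring
    rw [h5]
    linarith

lemma IsPiecewiseLinear.convexComb {k : PLAType} {n m : ℕ} {x y : ℕ → ℝ}
    (hu : IsPiecewiseLinear k n x m y u) (hv : IsPiecewiseLinear k n x m y v) (r s : ℝ) :
    IsPiecewiseLinear k n x m y (r • u + s • v) := by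
  intro i hi j hj p hp
  have h1 := hu i hi j hj p hp
  have h2 := hv i hi j hj p hp
  simp only [Pi.add_apply, Pi.smul_apply, smul_eq_mul]
  rw [cellInterp_eq] at h1 h2 ⊢
  rw [h1, h2]
  ring

lemma IsUtility.integrableOn (hu : IsUtility T L u) (ν : Measure (ℝ × ℝ)) [IsFiniteMeasure ν] :
    IntegrableOn u T.carrier ν :=
  hu.continuousOn.integrableOn_compact T.isCompact_carrier

lemma signedIntegral_convexComb (μ : SignedMeasure (ℝ × ℝ)) (hu : IsUtility T L u)
    (hv : IsUtility T L v) (r s : ℝ) :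
    signedIntegral T μ (r • u + s • v) = r * signedIntegral T μ u + s * signedIntegral T μ v := by
  have key : ∀ (ν : Measure (ℝ × ℝ)) [IsFiniteMeasure ν], ∫ p in T.carrier, (r • u + s • v) p ∂ν =
      r * (∫ p in T.carrier, u p ∂ν) + s * ∫ p in T.carrier, v p ∂ν := by
    intro ν _
    rw [← integral_const_mul, ← integral_const_mul,
      ← integral_add ((hu.integrableOn ν).const_mul r) ((hv.integrableOn ν).const_mul s)]
    rfl
  rw [signedIntegral, signedIntegral, signedIntegral, key, key]
  ring

/-- The two Jordan parts are bounded separately and may add up, hence the total variation on the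
right. -/
lemma signedIntegral_sub_le (μ : SignedMeasure (ℝ × ℝ)) (hu : IsUtility T L u)
    (hv : IsUtility T L v) {ε : ℝ} (h : ∀ p ∈ T.carrier, |u p - v p| ≤ ε) :
    signedIntegral T μ u - signedIntegral T μ v ≤ ε * variationOn T μ := by
  have key : ∀ (ν : Measure (ℝ × ℝ)) [IsFiniteMeasure ν],
      |(∫ p in T.carrier, u p ∂ν) - ∫ p in T.carrier, v p ∂ν| ≤ ε * (ν T.carrier).toReal := by
    intro ν _
    rw [← integral_sub (hu.integrableOn ν) (hv.integrableOn ν)]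
    exact norm_setIntegral_le_of_norm_le_const (f := fun p => u p - v p) (measure_lt_top ν _) h
  have h1 := abs_le.1 (key μ.toJordanDecomposition.posPart)
  have h2 := abs_le.1 (key μ.toJordanDecomposition.negPart)
  rw [variationOn, SignedMeasure.totalVariation, Measure.add_apply,
    ENNReal.toReal_add (measure_ne_top _ _) (measure_ne_top _ _), mul_add]
  simp only [signedIntegral]
  linarith [h1.2, h2.1]

lemma Slater.signedIntegral_le {M : ℕ} {μ : Fin M → SignedMeasure (ℝ × ℝ)} {c : Fin M → ℝ}
    {α : ℝ} (h : Slater T μ c α u) (l : Fin M) : signedIntegral T (μ l) u + α ≤ c l := by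
  -- The unit vector in direction `l` turns the ball condition into a margin `α` in constraint `l`.
  have := h (EuclideanSpace.single l 1) (by simp) l
  simp only [PiLp.single_apply, if_true, mul_one] at this
  linarith

/-- Every member of the ambiguity set is uniformly close to a piecewise linear one. -/
lemma exists_mem_ambiguitySetN {M : ℕ} {μ : Fin M → SignedMeasure (ℝ × ℝ)} {c : Fin M → ℝ}
    {α : ℝ} (hα : 0 < α) {u₀ : ℝ × ℝ → ℝ} (hu₀ : u₀ ∈ ambiguitySet T L μ c)
    (hSlater : Slater T μ c α u₀) (k : PLAType) {n m : ℕ} {x y : ℕ → ℝ}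
    (hx : IsGrid T.xlo T.xhi n x) (hy : IsGrid T.ylo T.yhi m y) {V : ℝ}
    (hV : ∀ l, variationOn T (μ l) ≤ V) (hV0 : 0 ≤ V)
    (hfine : L * (mesh n x + mesh m y) * V ≤ α) (hu : u ∈ ambiguitySet T L μ c) :
    ∃ w ∈ ambiguitySetN T L μ c k n x m y,
      ∀ p ∈ T.carrier, |w p - u p| ≤ L * (mesh n x + mesh m y) * (1 + V / α) := by
  set ε := L * (mesh n x + mesh m y)
  have hε : 0 ≤ ε := mul_nonneg hu.1.modulus_nonneg (add_nonneg hx.mesh_nonneg hy.mesh_nonneg)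
  -- The smallest weight for which the Slater margin `s * α` pays for the violation `ε * V`.
  set s := ε * V / α with hs
  have hs0 : 0 ≤ s := by positivity
  have hs1 : s ≤ 1 := (div_le_one hα).2 hfine
  have hsα : s * α = ε * V := div_mul_cancel₀ _ hα.ne'
  have hr0 : 0 ≤ 1 - s := sub_nonneg.2 hs1
  have hw := hu.1.gridInterp k hx hy
  have hw₀ := hu₀.1.gridInterp k hx hy
  have hd := fun p (hp : p ∈ T.carrier) => hu.1.abs_gridInterp_sub_le k hx hy hp
  have hd₀ := fun p (hp : p ∈ T.carrier) => hu₀.1.abs_gridInterp_sub_le k hx hy hp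
  refine ⟨(1 - s) • gridInterp k n x m y u + s • gridInterp k n x m y u₀,
    ⟨⟨hw.convexComb hw₀ hr0 hs0 (sub_add_cancel _ _), fun l => ?_⟩,
      (isPiecewiseLinear_gridInterp k hx hy).convexComb
        (isPiecewiseLinear_gridInterp k hx hy) _ _⟩, fun p hp => ?_⟩
  · rw [signedIntegral_convexComb (μ l) hw hw₀]
    have hεV := mul_le_mul_of_nonneg_left (hV l) hε
    have h1 : signedIntegral T (μ l) (gridInterp k n x m y u) ≤ c l + ε * V := by
      linarith [signedIntegral_sub_le (μ l) hw hu.1 hd, hu.2 l]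
    have h2 : signedIntegral T (μ l) (gridInterp k n x m y u₀) ≤ c l - α + ε * V := by
      linarith [signedIntegral_sub_le (μ l) hw₀ hu₀.1 hd₀, hSlater.signedIntegral_le l]
    have h3 := mul_le_mul_of_nonneg_left h1 hr0
    have h4 := mul_le_mul_of_nonneg_left h2 hs0
    -- `(1 - s) * (c l + ε * V) + s * (c l - α + ε * V) = c l + ε * V - s * α = c l`.
    nlinarith
  · have h1 := hd p hp
    have h2 : |gridInterp k n x m y u₀ p - gridInterp k n x m y u p| ≤ 1 := by
      rw [abs_le]
      constructor <;>
        linarith [(hw.mapsTo hp).1, (hw.mapsTo hp).2, (hw₀.mapsTo hp).1, (hw₀.mapsTo hp).2]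
    have e : ((1 - s) • gridInterp k n x m y u + s • gridInterp k n x m y u₀) p - u p =
        (gridInterp k n x m y u p - u p) +
          s * (gridInterp k n x m y u₀ p - gridInterp k n x m y u p) := by
      simp only [Pi.add_apply, Pi.smul_apply, smul_eq_mul]
      ring
    have h3 := abs_add_le (gridInterp k n x m y u p - u p)
      (s * (gridInterp k n x m y u₀ p - gridInterp k n x m y u p))
    rw [abs_mul, abs_of_nonneg hs0] at h3
    have h4 := mul_le_mul_of_nonneg_left h2 hs0
    have h5 : ε * (1 + V / α) = ε + s := by rw [hs]; ring
    rw [e, h5]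
    linarith

end Ambiguity

/-! ### Stability of the maximin problem -/

namespace DecisionProblem

variable {T : Rect} {L : ℝ} {n m : ℕ} (D : DecisionProblem T n m) {U V : Set (ℝ × ℝ → ℝ)}
  {u w : ℝ × ℝ → ℝ} {ε η : ℝ}

lemma ae_mem : ∀ᵐ ξ ∂D.P, ξ ∈ D.Ξ := D.P_supp

/-- Utilities are controlled on `T` only, so continuity of the composition is available only on the
compact set `Ξ`; this suffices because `Ξ` has full measure. -/
lemma aestronglyMeasurable_comp (hu : IsUtility T L u) {z : EuclideanSpace ℝ (Fin n)}
    (hz : z ∈ D.Z) : AEStronglyMeasurable (fun ξ => u (D.f (z, ξ))) D.P := by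
  have hc : ContinuousOn (fun ξ => u (D.f (z, ξ))) D.Ξ :=
    hu.continuousOn.comp (D.f_cont.comp (by fun_prop)).continuousOn fun ξ hξ => D.f_mem z hz ξ hξ
  have := hc.aestronglyMeasurable (μ := D.P) D.Ξ_compact.measurableSet
  rwa [Measure.restrict_eq_self_of_ae_mem D.ae_mem] at this

lemma integrable_comp (hu : IsUtility T L u) {z : EuclideanSpace ℝ (Fin n)} (hz : z ∈ D.Z) :
    Integrable (fun ξ => u (D.f (z, ξ))) D.P := by
  have := D.P_prob
  refine Integrable.of_bound (D.aestronglyMeasurable_comp hu hz) 1 ?_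
  filter_upwards [D.ae_mem] with ξ hξ
  have h := hu.mapsTo (D.f_mem z hz ξ hξ)
  rw [Real.norm_eq_abs, abs_of_nonneg h.1]
  exact h.2

lemma continuousOn_expectedUtility (hu : IsUtility T L u) :
    ContinuousOn (D.expectedUtility u) D.Z := by
  have := D.P_prob
  refine continuousOn_of_dominated (bound := fun _ => 1)
    (fun z hz => D.aestronglyMeasurable_comp hu hz) (fun z hz => ?_) (integrable_const 1) ?_
  · filter_upwards [D.ae_mem] with ξ hξ
    have h := hu.mapsTo (D.f_mem z hz ξ hξ)
    rw [Real.norm_eq_abs, abs_of_nonneg h.1]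
    exact h.2
  · filter_upwards [D.ae_mem] with ξ hξ
    exact hu.continuousOn.comp (D.f_cont.comp (by fun_prop)).continuousOn
      fun z hz => D.f_mem z hz ξ hξ

lemma expectedUtility_nonneg (hu : IsUtility T L u) {z : EuclideanSpace ℝ (Fin n)}
    (hz : z ∈ D.Z) : 0 ≤ D.expectedUtility u z := by
  refine integral_nonneg_of_ae ?_
  filter_upwards [D.ae_mem] with ξ hξ
  exact (hu.mapsTo (D.f_mem z hz ξ hξ)).1

lemma expectedUtility_le_add (hu : IsUtility T L u) (hw : IsUtility T L w)
    (h : ∀ p ∈ T.carrier, |w p - u p| ≤ ε) {z : EuclideanSpace ℝ (Fin n)} (hz : z ∈ D.Z) :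
    D.expectedUtility w z ≤ D.expectedUtility u z + ε := by
  have := D.P_prob
  have e : D.expectedUtility u z + ε = ∫ ξ, (u (D.f (z, ξ)) + ε) ∂D.P := by
    rw [integral_add (D.integrable_comp hu hz) (integrable_const ε)]
    simp [expectedUtility]
  rw [e]
  refine integral_mono_ae (D.integrable_comp hw hz)
    ((D.integrable_comp hu hz).add (integrable_const ε)) ?_
  filter_upwards [D.ae_mem] with ξ hξ
  have := (abs_le.1 (h _ (D.f_mem z hz ξ hξ))).2
  linarith

lemma bddBelow_expectedUtility (hU : ∀ u ∈ U, IsUtility T L u) {z : EuclideanSpace ℝ (Fin n)}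
    (hz : z ∈ D.Z) : BddBelow ((fun u => D.expectedUtility u z) '' U) :=
  ⟨0, forall_mem_image.2 fun u hu => D.expectedUtility_nonneg (hU u hu) hz⟩

/-- An infimum of continuous functions is upper semicontinuous, so it attains its maximum on a
compact set. -/
lemma optSet_nonempty (hU : ∀ u ∈ U, IsUtility T L u) : (D.optSet U).Nonempty := by
  have h : UpperSemicontinuousOn (D.robust U) D.Z := by
    have h1 : D.robust U = fun z => ⨅ u : U, D.expectedUtility u z :=
      funext fun z => sInf_image' (s := U) (f := fun u => D.expectedUtility u z)
    rw [h1]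
    refine upperSemicontinuousOn_ciInf (fun z hz => ?_)
      fun u => (D.continuousOn_expectedUtility (hU u u.2)).upperSemicontinuousOn
    exact ⟨0, forall_mem_range.2 fun u => D.expectedUtility_nonneg (hU u u.2) hz⟩
  obtain ⟨z, hz, hmax⟩ := h.exists_isMaxOn D.Z_nonempty D.Z_compact
  exact ⟨z, hz, hmax⟩

lemma optVal_eq {z : EuclideanSpace ℝ (Fin n)} (hz : z ∈ D.optSet U) :
    D.optVal U = D.robust U z := by
  have h : IsGreatest (D.robust U '' D.Z) (D.robust U z) :=
    ⟨mem_image_of_mem _ hz.1, forall_mem_image.2 fun z' hz' => hz.2 hz'⟩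
  exact h.csSup_eq

lemma robust_anti (hU : ∀ u ∈ U, IsUtility T L u) (hVU : V ⊆ U) (hV : V.Nonempty)
    {z : EuclideanSpace ℝ (Fin n)} (hz : z ∈ D.Z) : D.robust U z ≤ D.robust V z :=
  csInf_le_csInf (D.bddBelow_expectedUtility hU hz) (hV.image _) (image_mono hVU)

lemma robust_le_add (hU : ∀ u ∈ U, IsUtility T L u) (hV : ∀ u ∈ V, IsUtility T L u)
    (hUne : U.Nonempty) (h : ∀ u ∈ U, ∃ w ∈ V, ∀ p ∈ T.carrier, |w p - u p| ≤ ε)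
    {z : EuclideanSpace ℝ (Fin n)} (hz : z ∈ D.Z) : D.robust V z ≤ D.robust U z + ε := by
  rw [← sub_le_iff_le_add]
  refine le_csInf (hUne.image _) (forall_mem_image.2 fun u hu => ?_)
  obtain ⟨w, hw, hwu⟩ := h u hu
  rw [sub_le_iff_le_add]
  exact (csInf_le (D.bddBelow_expectedUtility hV hz) (mem_image_of_mem _ hw)).trans
    (D.expectedUtility_le_add (hU u hu) (hV w hw) hwu hz)

/-- Beyond the largest distance from a point of `Z` to the optimal set no point competes and the
growth function is `⊤`. Boundedness matters because a real `sSup` of an unbounded set is 0. -/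
lemma bddAbove_growth_le (U : Set (ℝ × ℝ → ℝ)) (η : ℝ) :
    BddAbove {τ : ℝ | D.growth U τ ≤ (η : EReal)} := by
  obtain ⟨C, hC⟩ := D.Z_compact.bddAbove_image
    (Metric.continuous_infDist_pt (D.optSet U)).continuousOn
  refine ⟨C, fun τ hτ => ?_⟩
  by_contra! hlt
  have htop : D.growth U τ = ⊤ := by
    refine le_antisymm le_top (le_iInf₂ fun z hz => absurd (hC (mem_image_of_mem _ hz.1)) ?_)
    exact not_le.2 (hlt.trans_le hz.2)
  rw [mem_ofPred_eq, htop, top_le_iff] at hτ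
  exact EReal.coe_ne_top η hτ

/-- The point `z` itself competes in the infimum defining the growth function at its own distance.
-/
lemma infDist_le_growthInv {z : EuclideanSpace ℝ (Fin n)} (hz : z ∈ D.Z)
    (h : D.optVal U - D.robust U z ≤ η) :
    Metric.infDist z (D.optSet U) ≤ D.growthInv U η := by
  have hmem : z ∈ {z' ∈ D.Z | Metric.infDist z (D.optSet U) ≤ Metric.infDist z' (D.optSet U)} :=
    ⟨hz, le_rfl⟩
  have hle : D.growth U (Metric.infDist z (D.optSet U)) ≤ (η : EReal) := by
    rw [growth]
    exact (biInf_le _ hmem).trans (EReal.coe_le_coe_iff.2 h)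
  exact le_csSup (D.bddAbove_growth_le U η) hle

/-- Replacing the ambiguity set by a subset which is uniformly `ε`-dense in it changes the optimal
value by at most `ε`, and the optimal solutions remain `ε`-optimal for the original problem. -/
lemma errorBounds_of_dense (hU : ∀ u ∈ U, IsUtility T L u) (hVU : V ⊆ U) (hUne : U.Nonempty)
    (h : ∀ u ∈ U, ∃ w ∈ V, ∀ p ∈ T.carrier, |w p - u p| ≤ ε) (hη : ε ≤ η) :
    (D.optSet U).Nonempty ∧ (D.optSet V).Nonempty ∧ |D.optVal V - D.optVal U| ≤ ε ∧
      deviation (D.optSet V) (D.optSet U) ≤ D.growthInv U η := by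
  have hV : ∀ u ∈ V, IsUtility T L u := fun u hu => hU u (hVU hu)
  have hVne : V.Nonempty := by
    obtain ⟨u, hu⟩ := hUne
    obtain ⟨w, hw, -⟩ := h u hu
    exact ⟨w, hw⟩
  obtain ⟨z, hz⟩ := D.optSet_nonempty hU
  obtain ⟨z', hz'⟩ := D.optSet_nonempty hV
  have hle : D.optVal U ≤ D.optVal V := by
    rw [D.optVal_eq hz, D.optVal_eq hz']
    exact (D.robust_anti hU hVU hVne hz.1).trans (hz'.2 hz.1)
  have hge : D.optVal V ≤ D.optVal U + ε := by
    rw [D.optVal_eq hz, D.optVal_eq hz']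
    exact (D.robust_le_add hU hV hUne h hz'.1).trans (add_le_add (hz.2 hz'.1) le_rfl)
  refine ⟨⟨z, hz⟩, ⟨z', hz'⟩, ?_, ?_⟩
  · rw [abs_of_nonneg (sub_nonneg.2 hle)]
    linarith
  · refine csSup_le (Nonempty.image _ ⟨z', hz'⟩) (forall_mem_image.2 fun y hy => ?_)
    refine D.infDist_le_growthInv hy.1 ?_
    -- A maximizer for `V` loses at most `ε` when evaluated with `U`, and `D.optVal U ≤ D.optVal V`,
    -- so its gap in the full problem is at most `ε ≤ η`.
    have := D.robust_le_add hU hV hUne h hy.1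
    rw [← D.optVal_eq hy] at this
    linarith

end DecisionProblem

lemma errorBounds_of_le {T : Rect} {L : ℝ} {M : ℕ} {μ : Fin M → SignedMeasure (ℝ × ℝ)}
    {c : Fin M → ℝ} {α : ℝ} (hα : 0 < α) {u₀ : ℝ × ℝ → ℝ} (hu₀ : u₀ ∈ ambiguitySet T L μ c)
    (hSlater : Slater T μ c α u₀) (k : PLAType) {x y : ℕ → ℕ → ℝ}
    (hx : ∀ N, 2 ≤ N → IsGrid T.xlo T.xhi N (x N)) (hy : ∀ N, 2 ≤ N → IsGrid T.ylo T.yhi N (y N))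
    (hβx : Tendsto (fun N => mesh N (x N)) atTop (𝓝 0))
    (hβy : Tendsto (fun N => mesh N (y N)) atTop (𝓝 0)) {κ : ℝ}
    (hκ : 1 + √(∑ l, variationOn T (μ l) ^ 2) / α ≤ κ) :
    ErrorBounds T L μ c k x y κ := by
  set V := √(∑ l, variationOn T (μ l) ^ 2)
  have hV0 : 0 ≤ V := Real.sqrt_nonneg _
  have hV : ∀ l, variationOn T (μ l) ≤ V := fun l => Real.le_sqrt_of_sq_le
    (Finset.single_le_sum (f := fun l => variationOn T (μ l) ^ 2)
      (fun i _ => sq_nonneg _) (Finset.mem_univ l))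
  have hL : 0 ≤ L := hu₀.1.modulus_nonneg
  -- Two meshes below this threshold give `ε * V ≤ α`, so that the mixing weight is at most 1; the
  -- `+ 1` covers `L * V = 0`. The threshold involves no decision problem.
  have hδ : 0 < α / (2 * (L * V + 1)) := by positivity
  obtain ⟨N₁, hN₁⟩ := eventually_atTop.1 (hβx.eventually_le_const hδ)
  obtain ⟨N₂, hN₂⟩ := eventually_atTop.1 (hβy.eventually_le_const hδ)
  refine ⟨max 2 N₁, max 2 N₂, fun n₁ n₂ hn₁ hn₂ => ?_⟩
  have hgx := hx n₁ ((le_max_left _ _).trans hn₁)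
  have hgy := hy n₂ ((le_max_left _ _).trans hn₂)
  have h1 := hN₁ n₁ ((le_max_right _ _).trans hn₁)
  have h2 := hN₂ n₂ ((le_max_right _ _).trans hn₂)
  have hβ : 0 ≤ mesh n₁ (x n₁) + mesh n₂ (y n₂) := add_nonneg hgx.mesh_nonneg hgy.mesh_nonneg
  have hfine : L * (mesh n₁ (x n₁) + mesh n₂ (y n₂)) * V ≤ α := by
    have h3 : mesh n₁ (x n₁) + mesh n₂ (y n₂) ≤ α / (L * V + 1) := by
      have e : α / (2 * (L * V + 1)) + α / (2 * (L * V + 1)) = α / (L * V + 1) := by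
        have : L * V + 1 ≠ 0 := by positivity
        field_simp
        norm_num
      linarith
    rw [le_div_iff₀ (by positivity)] at h3
    linarith
  have hdense : ∀ u ∈ ambiguitySet T L μ c,
      ∃ w ∈ ambiguitySetN T L μ c k n₁ (x n₁) n₂ (y n₂), ∀ p ∈ T.carrier,
        |w p - u p| ≤ L * (mesh n₁ (x n₁) + mesh n₂ (y n₂)) * κ := by
    intro u hu
    obtain ⟨w, hw, hwu⟩ := exists_mem_ambiguitySetN hα hu₀ hSlater k hgx hgy hV hV0 hfine hu
    exact ⟨w, hw, fun p hp =>
      (hwu p hp).trans (mul_le_mul_of_nonneg_left hκ (mul_nonneg hL hβ))⟩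
  have hκ0 : 0 ≤ κ := le_trans (by positivity) hκ
  have hB : 0 ≤ L * (mesh n₁ (x n₁) + mesh n₂ (y n₂)) * κ := mul_nonneg (mul_nonneg hL hβ) hκ0
  refine ⟨?_, fun n m D => D.errorBounds_of_dense (fun u hu => hu.1) (fun u hu => hu.1)
    ⟨u₀, hu₀⟩ hdense (by linarith)⟩
  obtain ⟨w, hw, -⟩ := hdense u₀ hu₀
  exact ⟨w, hw⟩

end BiUtility

theorem theorem5p2 (T : BiUtility.Rect) (L : ℝ) (M : ℕ)
    (ψ : Fin M → ℝ × ℝ → ℝ) (μ : Fin M → SignedMeasure (ℝ × ℝ))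
    (hμ : ∀ l, BiUtility.IsLSMeasure T (ψ l) (μ l))
    (c : Fin M → ℝ)
    (α : ℝ) (hα : 0 < α) (u₀ : ℝ × ℝ → ℝ)
    (hu₀ : u₀ ∈ BiUtility.ambiguitySet T L μ c) (hSlater : BiUtility.Slater T μ c α u₀)
    (k : BiUtility.PLAType) (x y : ℕ → ℕ → ℝ)
    (hx : ∀ N, 2 ≤ N → BiUtility.IsGrid T.xlo T.xhi N (x N))
    (hy : ∀ N, 2 ≤ N → BiUtility.IsGrid T.ylo T.yhi N (y N))
    (hβx : Tendsto (fun N => BiUtility.mesh N (x N)) atTop (𝓝 0))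
    (hβy : Tendsto (fun N => BiUtility.mesh N (y N)) atTop (𝓝 0)) :
    (∀ α' : ℝ, 0 < α' → α' < α →
      BiUtility.ErrorBounds T L μ c k x y
        (3 + 1 / α' * √(∑ l, BiUtility.variationOn T (μ l) ^ 2))) ∧
    ((∃ l, μ l T.carrier ≠ 0) →
      ∃ α' : ℝ, 0 < α' ∧ α' < α ∧
        BiUtility.ErrorBounds T L μ c k x y
          (3 + 1 / α' * √(∑ l, |μ l T.carrier| ^ 2))) := by
  set V := √(∑ l, BiUtility.variationOn T (μ l) ^ 2) with hVdef
  have hV : 0 ≤ V := Real.sqrt_nonneg _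
  have bounds : ∀ κ, 1 + V / α ≤ κ → BiUtility.ErrorBounds T L μ c k x y κ := fun κ hκ =>
    BiUtility.errorBounds_of_le hα hu₀ hSlater k hx hy hβx hβy hκ
  refine ⟨fun α' hα' hlt => bounds _ ?_, fun ⟨l, hl⟩ => ?_⟩
  · have : V / α ≤ V / α' := by gcongr
    rw [one_div_mul_eq_div]
    linarith
  · set S := √(∑ l, |μ l T.carrier| ^ 2)
    have hS : 0 < S := Real.sqrt_pos.2 (Finset.sum_pos' (fun i _ => by positivity)
      ⟨l, Finset.mem_univ l, by positivity⟩)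
    -- Chosen so that `S / α' = (S + V + 1) / α`, which dominates `V / α`. A nonzero net mass gives
    -- `S > 0`, hence `α' > 0`, and the `+ 1` keeps `α' < α` even when `V = 0`.
    refine ⟨α * S / (S + V + 1), by positivity, ?_, bounds _ ?_⟩
    · rw [div_lt_iff₀ (by positivity)]
      exact mul_lt_mul_of_pos_left (by linarith) hα
    · have e : 1 / (α * S / (S + V + 1)) * S = (S + V + 1) / α := by
        field_simp
      have : V / α ≤ (S + V + 1) / α := by
        gcongr
        linarith
      rw [e]
      linarith
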